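/- For a positive integer $N$ let $E^N=\{0,1\}^N$, with coordinatewise addition $\oplus$ modulo $2$. A binary $(N,K,d)$-code is a set $C\subseteq E^N$ with $|C|=K$ in which any two distinct words are at Hamming distance at least $d$. Let $\beta,\gamma:\mathbb Z_4\to\{0,1\}$ map $0,1,2,3$ to $0,0,1,1$ and to $0,1,1,0$, respectively, and let the Gray map be $\phi:\mathbb Z_4^n\to E^{2n}$, $\phi(c)=(\beta(c_1),\dots,\beta(c_n),\gamma(c_1),\dots,\gamma(c_n))$. A code $C\subseteq E^{2n}$ is called $Z_4$-linear if $C=\pi(\phi(\mathcal C))$ for some additive subgroup $\mathcal C$ of $\mathbb Z_4^n$ and some permutation $\pi$ of the $2n$ coordinates. Codes $C,C'\subseteq E^N$ are equivalent if $C=\pi(C'\oplus y)$ for some $y\in E^N$ and some permutation $\pi$ of the $N$ coordinates. Theorem. If $N=2^k\ge 16$, then there exist exactly $\lfloor (k+1)/2\rfloor$ pairwise nonequivalent $Z_4$-linear extended perfect codes of length $N$, i.e. the set of $Z_4$-linear binary $(N,2^N/(2N),4)$-codes splits into exactly $\lfloor (k+1)/2\rfloor$ equivalence classes. -/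

import Mathlib

/-- The set `E^N` of binary words of length `N`; `⊕` is the addition modulo 2. -/
abbrev BinWord (N : ℕ) : Type := Fin N → ZMod 2

/-- `C` is a binary `(N, K, d)`-code: `|C| = K`, and distinct codewords are at Hamming distance
at least `d`. -/
def IsBinaryCode (N K d : ℕ) (C : Set (BinWord N)) : Prop :=
  C.ncard = K ∧ ∀ a ∈ C, ∀ b ∈ C, a ≠ b → d ≤ hammingDist a b

/-- The coordinate map `β` : `0, 1, 2, 3 ↦ 0, 0, 1, 1`. -/
def grayBeta (c : ZMod 4) : ZMod 2 := if c = 2 ∨ c = 3 then 1 else 0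

/-- The coordinate map `γ` : `0, 1, 2, 3 ↦ 0, 1, 1, 0`. -/
def grayGamma (c : ZMod 4) : ZMod 2 := if c = 1 ∨ c = 2 then 1 else 0

/-- The Gray map `φ(c) = (β(c), γ(c))` from `Z_4^n` to `E^{2n}`. -/
def grayMap {n : ℕ} (c : Fin n → ZMod 4) : BinWord (n + n) :=
  Fin.append (fun i => grayBeta (c i)) (fun i => grayGamma (c i))

/-- Move the symbol in position `i` of `x` to position `π i`. -/
def permuteWord {M N : ℕ} (π : Fin M ≃ Fin N) (x : BinWord M) : BinWord N :=
  fun i => x (π.symm i)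

/-- `C` is `Z_4`-linear: `C = π(φ(𝒞))` for a quaternary code `𝒞` (an additive subgroup of `Z_4^n`)
and a permutation `π` of the coordinates. The existence of the bijection `π` forces `N = 2n`. -/
def IsZ4Linear {N : ℕ} (C : Set (BinWord N)) : Prop :=
  ∃ (n : ℕ) (𝒞 : AddSubgroup (Fin n → ZMod 4)) (π : Fin (n + n) ≃ Fin N),
    C = permuteWord π '' (grayMap '' (𝒞 : Set (Fin n → ZMod 4)))

/-- Binary codes `C`, `C'` are equivalent: `C = π(C' ⊕ y)` for a word `y` and a permutation `π` of
the coordinates. -/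
def CodeEquiv {N : ℕ} (C C' : Set (BinWord N)) : Prop :=
  ∃ (y : BinWord N) (π : Equiv.Perm (Fin N)), C = permuteWord π '' ((fun x => x + y) '' C')

theorem CodeEquiv.refl {N : ℕ} (C : Set (BinWord N)) : CodeEquiv C C := by
  refine ⟨0, 1, ?_⟩
  have h (x : BinWord N) : permuteWord (1 : Equiv.Perm (Fin N)) x = x := rfl
  ext x
  simp [h]

theorem CodeEquiv.symm {N : ℕ} {C C' : Set (BinWord N)} (h : CodeEquiv C C') :
    CodeEquiv C' C := by
  obtain ⟨y, π, rfl⟩ := h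
  refine ⟨permuteWord π (-y), π.symm, ?_⟩
  rw [Set.image_image, Set.image_image, Set.image_image]
  symm
  convert Set.image_id C' using 2
  ext x
  simp [permuteWord, add_assoc, CharTwo.add_self_eq_zero]

theorem CodeEquiv.trans {N : ℕ} {C C' C'' : Set (BinWord N)} (h : CodeEquiv C C')
    (h' : CodeEquiv C' C'') : CodeEquiv C C'' := by
  obtain ⟨y, π, rfl⟩ := h
  obtain ⟨z, σ, rfl⟩ := h'
  refine ⟨z + permuteWord σ.symm y, σ.trans π, ?_⟩
  simp only [Set.image_image]
  congr 1
  ext x i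
  simp [permuteWord, add_assoc]

/-- The `Z_4`-linear extended perfect `(N, 2^N/2N, 4)`-codes. -/
def Z4LinearExtendedPerfectCode (N : ℕ) : Type :=
  {C : Set (BinWord N) // IsZ4Linear C ∧ IsBinaryCode N (2 ^ N / (2 * N)) 4 C}

/-- Equivalence of binary codes, restricted to the `Z_4`-linear extended perfect codes. -/
def z4CodeSetoid (N : ℕ) : Setoid (Z4LinearExtendedPerfectCode N) where
  r C C' := CodeEquiv C.1 C'.1
  iseqv := ⟨fun C => CodeEquiv.refl C.1, CodeEquiv.symm, CodeEquiv.trans⟩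

/-! The Gray map is an isometry from the Lee metric to the Hamming metric, so the question concerns
subgroups `𝒞` of `Z_4^n`, `n = N/2`, with quotient of order `4n` and minimum Lee weight at least 4.

Classification (`exists_parityCheckCode_of_perfect`): in `A = Z_4^n / 𝒞` the classes of the `±e_i`
are `2n` distinct elements, half of `A`, and form a symmetric sum-free set. Such a set is `χ = 1`
for a character `χ : A → Z_2`. It contains no element of order two, so `χ` lifts to `r : A → Z_4`
because `Z_4` is self-injective. With signs chosen so that `r = 1` on every column, the columns
become `(1, v)` with `v` running once through `B = ker r`. Hence `𝒞` is determined up to signed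
permutation by the module `B ≅ Z_4^j × Z_2^b`, where `2j + b = k - 1`, which leaves `⌊(k+1)/2⌋`
values of `j`.

Separation (`not_codeEquiv_of_lt`): the number of binary words with constant inner product on the
code is invariant under equivalence. It is at least `2 |Hom(B, Z_2)| = 2^(1+j+b)`, with equality
when `B` has an element of order 4 and more than four elements. For fixed `2j + b` this decreases
with `j`. -/

/-- Reduction modulo 2 on `ZMod 4`. -/
abbrev lowBit : ZMod 4 →+* ZMod 2 := ZMod.castHom (by norm_num : 2 ∣ 4) (ZMod 2)

instance zmodTwoModuleZModFour : Module (ZMod 4) (ZMod 2) := Module.compHom (ZMod 2) lowBit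

theorem zmodFour_smul_zmodTwo (c : ZMod 4) (x : ZMod 2) : c • x = lowBit c * x := rfl

/-! ### Gray map and Lee weight -/

/-- The Gray image of a quaternary word indexed by `ι`, as a binary word indexed by `ι ⊕ ι`. -/
def grayWord {ι : Type*} (c : ι → ZMod 4) : ι ⊕ ι → ZMod 2 :=
  Sum.elim (fun i => grayBeta (c i)) (fun i => grayGamma (c i))

theorem grayMap_eq_grayWord {n : ℕ} (c : Fin n → ZMod 4) :
    grayMap c = grayWord c ∘ finSumFinEquiv.symm := by
  funext i
  obtain ⟨x, rfl⟩ := finSumFinEquiv.surjective i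
  rw [Function.comp_apply, Equiv.symm_apply_apply]
  cases x
  · exact Fin.append_left _ _ _
  · exact Fin.append_right _ _ _

theorem grayBeta_grayGamma_injective :
    ∀ x y : ZMod 4, grayBeta x = grayBeta y → grayGamma x = grayGamma y → x = y := by
  decide

theorem grayWord_injective {ι : Type*} :
    Function.Injective (grayWord : (ι → ZMod 4) → ι ⊕ ι → ZMod 2) := by
  intro c d h
  funext i
  exact grayBeta_grayGamma_injective _ _ (congrFun h (Sum.inl i)) (congrFun h (Sum.inr i))

/-- The Lee weight of a quaternary symbol. -/
def leeSymbol (x : ZMod 4) : ℕ := if x = 0 then 0 else if x = 2 then 2 else 1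

/-- The Lee weight of a quaternary word. -/
def leeWeight {ι : Type*} [Fintype ι] (c : ι → ZMod 4) : ℕ := ∑ i, leeSymbol (c i)

theorem leeSymbol_add_le : ∀ x y : ZMod 4, leeSymbol (x + y) ≤ leeSymbol x + leeSymbol y := by
  decide

theorem leeWeight_add_le {ι : Type*} [Fintype ι] (c d : ι → ZMod 4) :
    leeWeight (c + d) ≤ leeWeight c + leeWeight d := by
  unfold leeWeight
  rw [← Finset.sum_add_distrib]
  exact Finset.sum_le_sum fun i _ => leeSymbol_add_le _ _

theorem leeWeight_single {ι : Type*} [Fintype ι] [DecidableEq ι] (i : ι) (x : ZMod 4) :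
    leeWeight (Pi.single i x) = leeSymbol x := by
  unfold leeWeight
  rw [Finset.sum_eq_single i]
  · simp
  · intro j _ hj
    simp [hj, leeSymbol]
  · simp

theorem hammingDist_gray_symbol : ∀ x y : ZMod 4,
    (if grayBeta x ≠ grayBeta y then 1 else 0) + (if grayGamma x ≠ grayGamma y then 1 else 0)
      = leeSymbol (x - y) := by
  decide

theorem hammingDist_grayWord {ι : Type*} [Fintype ι] (c d : ι → ZMod 4) :
    hammingDist (grayWord c) (grayWord d) = leeWeight (c - d) := by
  unfold hammingDist leeWeight
  rw [Finset.card_filter, Fintype.sum_sum_type, ← Finset.sum_add_distrib]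
  exact Finset.sum_congr rfl fun i _ => hammingDist_gray_symbol _ _

theorem hammingDist_comp_equiv {X Y α : Type*} [Fintype X] [Fintype Y] [DecidableEq α]
    (e : X ≃ Y) (a b : Y → α) : hammingDist (a ∘ e) (b ∘ e) = hammingDist a b := by
  unfold hammingDist
  rw [Finset.card_filter, Finset.card_filter]
  exact Equiv.sum_comp e fun i => if a i ≠ b i then 1 else 0

/-- The binary code of length `N` obtained from a quaternary code over the index set `ι`. -/
def grayImage {ι : Type*} {N : ℕ} (e : ι ⊕ ι ≃ Fin N) (𝒞 : Set (ι → ZMod 4)) :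
    Set (BinWord N) :=
  (fun c => grayWord c ∘ e.symm) '' 𝒞

theorem grayImage_injective {ι : Type*} {N : ℕ} (e : ι ⊕ ι ≃ Fin N) :
    Function.Injective (fun c : ι → ZMod 4 => (grayWord c ∘ e.symm : BinWord N)) :=
  e.symm.surjective.injective_comp_right.comp grayWord_injective

theorem ncard_grayImage {ι : Type*} {N : ℕ} (e : ι ⊕ ι ≃ Fin N) (𝒞 : Set (ι → ZMod 4)) :
    (grayImage e 𝒞).ncard = 𝒞.ncard :=
  Set.ncard_image_of_injective _ (grayImage_injective e)

/-- The Gray map is not additive, but it carries the Lee weight of a difference to Hamming distance,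
so the minimum distance is the minimum Lee weight of a subgroup. -/
theorem isBinaryCode_grayImage {ι : Type*} [Fintype ι] {N K d : ℕ} (e : ι ⊕ ι ≃ Fin N)
    (𝒞 : AddSubgroup (ι → ZMod 4)) :
    IsBinaryCode N K d (grayImage e (𝒞 : Set (ι → ZMod 4))) ↔
      Nat.card 𝒞 = K ∧ ∀ c ∈ 𝒞, c ≠ 0 → d ≤ leeWeight c := by
  unfold IsBinaryCode
  rw [ncard_grayImage]
  refine and_congr Iff.rfl ⟨fun h c hc hc0 => ?_, ?_⟩
  · have := h _ ⟨c, hc, rfl⟩ _ ⟨0, 𝒞.zero_mem, rfl⟩ ((grayImage_injective e).ne hc0)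
    simpa [hammingDist_comp_equiv, hammingDist_grayWord] using this
  · rintro h _ ⟨a, ha, rfl⟩ _ ⟨b, hb, rfl⟩ hab
    have hne : a - b ≠ 0 := by
      rintro h0
      exact hab (by rw [sub_eq_zero.1 h0])
    simpa [hammingDist_comp_equiv, hammingDist_grayWord] using h _ (𝒞.sub_mem ha hb) hne

/-! ### Signed permutations and equivalence of Gray images -/

theorem grayBeta_neg : ∀ x : ZMod 4, grayBeta (-x) = grayGamma x := by decide

theorem grayGamma_neg : ∀ x : ZMod 4, grayGamma (-x) = grayBeta x := by decide

/-- A signed permutation of quaternary coordinates acts on the Gray image by a permutation. -/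
theorem exists_equiv_grayWord_signed {ι κ : Type*} (σ : ι ≃ κ) (ε : ι → ZMod 4)
    (hε : ∀ i, ε i = 1 ∨ ε i = -1) :
    ∃ τ : ι ⊕ ι ≃ κ ⊕ κ, ∀ c : κ → ZMod 4,
      grayWord (fun i => ε i * c (σ i)) = grayWord c ∘ τ := by
  classical
  -- Negating a symbol exchanges its two bits, so `s` swaps the two copies of `i` exactly where the
  -- sign is `-1`.
  let s : ι ⊕ ι → ι ⊕ ι := Sum.elim (fun i => if ε i = 1 then Sum.inl i else Sum.inr i)
    (fun i => if ε i = 1 then Sum.inr i else Sum.inl i)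
  have hs : Function.Involutive s := by
    rintro (i | i) <;> by_cases h : ε i = 1 <;> simp [s, h]
  refine ⟨(hs.toPerm s).trans (Equiv.sumCongr σ σ), fun c => ?_⟩
  have hne : (-1 : ZMod 4) ≠ 1 := by decide
  funext x
  rcases x with i | i <;> rcases hε i with h | h <;>
    simp [s, h, hne, grayWord, grayBeta_neg, grayGamma_neg]

theorem codeEquiv_grayImage {ι κ : Type*} {N : ℕ} (e : ι ⊕ ι ≃ Fin N) (e' : κ ⊕ κ ≃ Fin N)
    (σ : ι ≃ κ) (ε : ι → ZMod 4) (hε : ∀ i, ε i = 1 ∨ ε i = -1)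
    {𝒞 : Set (ι → ZMod 4)} {𝒟 : Set (κ → ZMod 4)}
    (h : ∀ c : κ → ZMod 4, c ∈ 𝒟 ↔ (fun i => ε i * c (σ i)) ∈ 𝒞) :
    CodeEquiv (grayImage e 𝒞) (grayImage e' 𝒟) := by
  obtain ⟨τ, hτ⟩ := exists_equiv_grayWord_signed σ ε hε
  have hsq : ∀ i, ε i * ε i = 1 := by
    intro i
    rcases hε i with h | h <;> simp [h]
  have h𝒞 : 𝒞 = (fun (c : κ → ZMod 4) i => ε i * c (σ i)) '' 𝒟 := by
    ext d
    constructor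
    · intro hd
      have hdd : (fun i => ε i * (ε (σ.symm (σ i)) * d (σ.symm (σ i)))) = d := by
        funext i
        simp [← mul_assoc, hsq]
      exact ⟨fun k => ε (σ.symm k) * d (σ.symm k), (h _).2 (by rwa [hdd]), hdd⟩
    · rintro ⟨c, hc, rfl⟩
      exact (h c).1 hc
  refine ⟨0, (e'.symm.trans τ.symm).trans e, ?_⟩
  subst h𝒞
  simp only [grayImage, Set.image_image, add_zero, hτ]
  refine Set.image_congr fun c _ => ?_
  funext i
  simp [permuteWord]

theorem isZ4Linear_iff_exists_grayImage {N : ℕ} {C : Set (BinWord N)} :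
    IsZ4Linear C ↔ ∃ (n : ℕ) (𝒞 : AddSubgroup (Fin n → ZMod 4)) (e : Fin n ⊕ Fin n ≃ Fin N),
      C = grayImage e 𝒞 := by
  unfold IsZ4Linear grayImage
  refine exists_congr fun n => exists_congr fun 𝒞 => ⟨?_, ?_⟩
  · rintro ⟨π, rfl⟩
    refine ⟨finSumFinEquiv.trans π, ?_⟩
    rw [Set.image_image]
    refine Set.image_congr fun c _ => ?_
    rw [grayMap_eq_grayWord]
    rfl
  · rintro ⟨e, rfl⟩
    refine ⟨finSumFinEquiv.symm.trans e, ?_⟩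
    rw [Set.image_image]
    refine Set.image_congr fun c _ => ?_
    rw [grayMap_eq_grayWord]
    funext i
    simp [permuteWord]

theorem isZ4Linear_grayImage {ι : Type*} [Finite ι] {N : ℕ} (e : ι ⊕ ι ≃ Fin N)
    (𝒞 : AddSubgroup (ι → ZMod 4)) : IsZ4Linear (grayImage e (𝒞 : Set (ι → ZMod 4))) := by
  obtain ⟨n, ⟨f⟩⟩ := Finite.exists_equiv_fin ι
  rw [isZ4Linear_iff_exists_grayImage]
  let φ : (Fin n → ZMod 4) →+ (ι → ZMod 4) :=
    { toFun := fun c i => c (f i), map_zero' := rfl, map_add' := fun _ _ => rfl }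
  refine ⟨n, 𝒞.comap φ, (Equiv.sumCongr f.symm f.symm).trans e, ?_⟩
  ext x
  constructor
  · rintro ⟨c, hc, rfl⟩
    refine ⟨fun i => c (f.symm i), ?_, ?_⟩
    · simpa [φ] using hc
    · funext i
      rcases h : e.symm i with j | j <;> simp [h, grayWord]
  · rintro ⟨c, hc, rfl⟩
    refine ⟨φ c, hc, ?_⟩
    funext i
    rcases h : e.symm i with j | j <;> simp [h, grayWord, φ]

/-! ### Parity-check codes -/

/-- The quaternary code with parity-check columns `(1, v)`, where `v` runs over the module `B`. -/
def parityCheckCode (B : Type*) [Fintype B] [AddCommGroup B] [Module (ZMod 4) B] :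
    Submodule (ZMod 4) (B → ZMod 4) :=
  LinearMap.ker (Fintype.linearCombination (ZMod 4) (fun v : B => ((1 : ZMod 4), v)))

section ParityCheckCode

variable {B : Type*} [Fintype B] [AddCommGroup B] [Module (ZMod 4) B]

theorem mem_parityCheckCode {c : B → ZMod 4} :
    c ∈ parityCheckCode B ↔ ∑ v, c v = 0 ∧ ∑ v, c v • v = 0 := by
  simp [parityCheckCode, Fintype.linearCombination_apply, Prod.ext_iff, Prod.fst_sum,
    Prod.snd_sum]

theorem card_parityCheckCode_mul [DecidableEq B] :
    Nat.card (parityCheckCode B) * (4 * Fintype.card B) = 4 ^ Fintype.card B := by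
  let L := Fintype.linearCombination (ZMod 4) (fun v : B => ((1 : ZMod 4), v))
  have hL : Function.Surjective L := by
    rintro ⟨a, v⟩
    -- The column at `0` is `(1, 0)`, so it corrects the first component without touching the
    -- second.
    refine ⟨Pi.single v 1 + Pi.single 0 (a - 1), ?_⟩
    simp [L, Fintype.linearCombination_apply_single]
  have h := Submodule.card_eq_card_quotient_mul_card (LinearMap.ker L)
  rw [Nat.card_congr (L.quotKerEquivOfSurjective hL).toEquiv] at h
  have h1 : Nat.card (ZMod 4 × B) = 4 * Fintype.card B := by simp
  have h2 : Nat.card (B → ZMod 4) = 4 ^ Fintype.card B := by simp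
  rw [h1, h2] at h
  rw [mul_comm] at h
  exact (h.trans (mul_comm _ _)).symm

theorem leeSymbol_mod_two : ∀ x : ZMod 4, (leeSymbol x : ZMod 2) = lowBit x := by decide

theorem leeSymbol_pos : ∀ x : ZMod 4, x ≠ 0 → 1 ≤ leeSymbol x := by decide

theorem eq_one_or_neg_one_of_leeSymbol : ∀ x : ZMod 4, x ≠ 0 → leeSymbol x ≤ 1 → x = 1 ∨ x = -1 := by
  decide

/-- Lee weight has the parity of the coordinate sum, so it is even. In weight 2, the zero sum rules
out a single nonzero position; two positions then carry opposite units, and the second check makes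
their columns coincide. -/
theorem le_leeWeight_of_mem_parityCheckCode [DecidableEq B] {c : B → ZMod 4}
    (hc : c ∈ parityCheckCode B) (h0 : c ≠ 0) : 4 ≤ leeWeight c := by
  obtain ⟨hs, hw⟩ := mem_parityCheckCode.1 hc
  obtain ⟨i, hi⟩ := Function.ne_iff.1 h0
  have hev : 2 ∣ leeWeight c := by
    rw [← ZMod.natCast_eq_zero_iff, leeWeight, Nat.cast_sum]
    simp only [leeSymbol_mod_two]
    rw [← map_sum, hs, map_zero]
  obtain ⟨j, hj, hji⟩ : ∃ j, c j ≠ 0 ∧ j ≠ i := by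
    by_contra! h
    rw [Finset.sum_eq_single i (fun j _ hj => by_contra fun h' => hj (h j h')) (by simp)] at hs
    exact hi hs
  by_contra! hlt
  have h2 : leeWeight c ≤ 2 := by omega
  have hpair : ∀ l, l ≠ i → l ≠ j → c l = 0 := by
    intro l hli hlj
    by_contra hl
    have h3 : ∑ m ∈ ({i, j, l} : Finset B), leeSymbol (c m) ≤ leeWeight c :=
      Finset.sum_le_sum_of_subset (Finset.subset_univ _)
    rw [Finset.sum_insert (by simp [hji.symm, hli.symm]), Finset.sum_pair hlj.symm] at h3
    have := leeSymbol_pos _ hi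
    have := leeSymbol_pos _ hj
    have := leeSymbol_pos _ hl
    omega
  have h3 : ∑ m ∈ ({i, j} : Finset B), leeSymbol (c m) ≤ leeWeight c :=
    Finset.sum_le_sum_of_subset (Finset.subset_univ _)
  rw [Finset.sum_pair hji.symm] at h3
  have hi1 := leeSymbol_pos _ hi
  have hj1 := leeSymbol_pos _ hj
  have hsupp : ∀ l ∈ Finset.univ, l ∉ ({i, j} : Finset B) → c l = 0 := by
    intro l _ hl
    simp only [Finset.mem_insert, Finset.mem_singleton, not_or] at hl
    exact hpair l hl.1 hl.2
  rw [← Finset.sum_subset (Finset.subset_univ {i, j}) hsupp, Finset.sum_pair hji.symm] at hs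
  rw [← Finset.sum_subset (Finset.subset_univ {i, j})
    (fun l hl hl' => by rw [hsupp l hl hl', zero_smul]), Finset.sum_pair hji.symm,
    eq_neg_of_add_eq_zero_right hs, neg_smul, ← sub_eq_add_neg, ← smul_sub] at hw
  refine hji ?_
  rcases eq_one_or_neg_one_of_leeSymbol _ hi (by omega) with h | h <;>
  · rw [h] at hw
    simp only [one_smul, neg_smul, neg_eq_zero, sub_eq_zero] at hw
    exact hw.symm

theorem isBinaryCode_grayImage_parityCheckCode {N : ℕ} (hN : 0 < N) (e : B ⊕ B ≃ Fin N) :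
    IsBinaryCode N (2 ^ N / (2 * N)) 4 (grayImage e (parityCheckCode B : Set (B → ZMod 4))) := by
  classical
  have hcard : Fintype.card B + Fintype.card B = N := by
    simpa using Fintype.card_congr e
  refine (isBinaryCode_grayImage e (parityCheckCode B).toAddSubgroup).2
    ⟨?_, fun c hc h0 => le_leeWeight_of_mem_parityCheckCode hc h0⟩
  refine (Nat.div_eq_of_eq_mul_left (by omega) ?_).symm
  have h := card_parityCheckCode_mul (B := B)
  rw [show 4 * Fintype.card B = 2 * N by omega] at h
  rw [show 2 ^ N = 4 ^ Fintype.card B by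
    rw [← hcard, ← two_mul, pow_mul]; norm_num, ← h]
  rfl

/-- Isomorphic modules give equivalent binary codes. -/
theorem codeEquiv_parityCheckCode {B' : Type*} [Fintype B'] [AddCommGroup B']
    [Module (ZMod 4) B'] {N : ℕ} (e : B ⊕ B ≃ Fin N) (e' : B' ⊕ B' ≃ Fin N)
    (θ : B ≃ₗ[ZMod 4] B') :
    CodeEquiv (grayImage e (parityCheckCode B : Set (B → ZMod 4)))
      (grayImage e' (parityCheckCode B' : Set (B' → ZMod 4))) := by
  refine codeEquiv_grayImage e e' θ.toEquiv (fun _ => 1) (fun _ => Or.inl rfl) fun c => ?_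
  simp only [SetLike.mem_coe, mem_parityCheckCode, one_mul]
  rw [← Equiv.sum_comp θ.toEquiv c, ← Equiv.sum_comp θ.toEquiv (fun v => c v • v)]
  refine and_congr Iff.rfl ?_
  rw [← map_eq_zero_iff θ θ.injective, map_sum]
  simp

end ParityCheckCode

/-! ### The invariant: constant checks -/

/-- The words having a constant inner product with all the words of `C`. -/
def constantChecks {N : ℕ} (C : Set (BinWord N)) : Set (BinWord N) :=
  {y | ∃ t, ∀ x ∈ C, ∑ i, y i * x i = t}

/-- A translation only changes the constant `t`, and a permutation carries checks to checks; this is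
why checks are allowed any constant rather than only 0. -/
theorem ncard_constantChecks_le_of_codeEquiv {N : ℕ} {C C' : Set (BinWord N)}
    (h : CodeEquiv C C') : (constantChecks C).ncard ≤ (constantChecks C').ncard := by
  obtain ⟨z, π, rfl⟩ := h
  refine Set.ncard_le_ncard_of_injOn (fun y => y ∘ π) ?_
    (π.surjective.injective_comp_right.injOn) (Set.toFinite _)
  rintro y ⟨t, ht⟩
  refine ⟨t - ∑ i, y (π i) * z i, fun x hx => ?_⟩
  have := ht _ ⟨_, ⟨x, hx, rfl⟩, rfl⟩
  rw [← this, ← Equiv.sum_comp π (fun i => y i * _), eq_sub_iff_add_eq, ← Finset.sum_add_distrib]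
  refine Finset.sum_congr rfl fun i _ => ?_
  simp [permuteWord, mul_add]

theorem ncard_constantChecks_eq_of_codeEquiv {N : ℕ} {C C' : Set (BinWord N)}
    (h : CodeEquiv C C') : (constantChecks C).ncard = (constantChecks C').ncard :=
  le_antisymm (ncard_constantChecks_le_of_codeEquiv h)
    (ncard_constantChecks_le_of_codeEquiv h.symm)

theorem mem_constantChecks_grayImage {ι : Type*} [Fintype ι] {N : ℕ} (e : ι ⊕ ι ≃ Fin N)
    (𝒞 : AddSubgroup (ι → ZMod 4)) {y : BinWord N} :
    y ∈ constantChecks (grayImage e (𝒞 : Set (ι → ZMod 4))) ↔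
      ∀ c ∈ 𝒞, ∑ i, (y (e (Sum.inl i)) * grayBeta (c i) + y (e (Sum.inr i)) * grayGamma (c i))
        = 0 := by
  have key : ∀ c : ι → ZMod 4, ∑ j, y j * (grayWord c ∘ e.symm) j =
      ∑ i, (y (e (Sum.inl i)) * grayBeta (c i) + y (e (Sum.inr i)) * grayGamma (c i)) := by
    intro c
    rw [← Equiv.sum_comp e, Fintype.sum_sum_type, ← Finset.sum_add_distrib]
    simp [grayWord]
  constructor
  · rintro ⟨t, ht⟩ c hc
    have h0 := ht _ ⟨0, 𝒞.zero_mem, rfl⟩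
    have h1 := ht _ ⟨c, hc, rfl⟩
    simp only [key] at h0 h1
    rw [h1, ← h0]
    have hβ : grayBeta 0 = 0 := rfl
    have hγ : grayGamma 0 = 0 := rfl
    simp [hβ, hγ]
  · intro h
    refine ⟨0, ?_⟩
    rintro _ ⟨c, hc, rfl⟩
    simp only [key]
    exact h c hc

theorem grayBeta_add_grayGamma : ∀ x : ZMod 4, grayBeta x + grayGamma x = lowBit x := by decide

/-- The product term measures the failure of additivity; it is what forces a check to agree on both
bits of a symbol in `eq_of_mem_constantChecks`. -/
theorem grayBeta_add :
    ∀ x y : ZMod 4, grayBeta (x + y) = grayBeta x + grayBeta y + lowBit x * lowBit y := by decide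

theorem grayGamma_add :
    ∀ x y : ZMod 4, grayGamma (x + y) = grayGamma x + grayGamma y + lowBit x * lowBit y := by
  decide

section Invariant

variable {B : Type*} [Fintype B] [AddCommGroup B] [Module (ZMod 4) B]

/-- Every affine function `a + f v`, repeated on both copies of `B`, is a check: since `β + γ` is
reduction mod 2, it sees only the parity-check equations mod 2. -/
theorem card_le_ncard_constantChecks {N : ℕ} (e : B ⊕ B ≃ Fin N) :
    Nat.card (ZMod 2 × (B →ₗ[ZMod 4] ZMod 2)) ≤
      (constantChecks (grayImage e (parityCheckCode B : Set (B → ZMod 4)))).ncard := by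
  let F : ZMod 2 × (B →ₗ[ZMod 4] ZMod 2) → BinWord N := fun p =>
    (Sum.elim (fun v => p.1 + p.2 v) (fun v => p.1 + p.2 v) : B ⊕ B → ZMod 2) ∘ e.symm
  have hFv : ∀ p v, F p (e (Sum.inl v)) = p.1 + p.2 v := by
    intro p v
    simp [F]
  have hFw : ∀ p v, F p (e (Sum.inr v)) = p.1 + p.2 v := by
    intro p v
    simp [F]
  have hF : Function.Injective F := by
    intro p q hpq
    have h1 : ∀ v, p.1 + p.2 v = q.1 + q.2 v := by
      intro v
      rw [← hFv, ← hFv, hpq]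
    have h2 : p.1 = q.1 := by simpa using h1 0
    refine Prod.ext h2 (LinearMap.ext fun v => ?_)
    have := h1 v
    rwa [h2, add_right_inj] at this
  rw [← Set.ncard_univ, ← Set.ncard_image_of_injective _ hF]
  refine Set.ncard_le_ncard ?_ (Set.toFinite _)
  rintro _ ⟨p, -, rfl⟩
  refine (mem_constantChecks_grayImage e (parityCheckCode B).toAddSubgroup).2 fun c hc => ?_
  obtain ⟨hs, hw⟩ := mem_parityCheckCode.1 hc
  simp only [hFv, hFw, ← mul_add, grayBeta_add_grayGamma]
  simp only [add_mul]
  rw [Finset.sum_add_distrib, ← Finset.mul_sum, ← map_sum, hs, map_zero, mul_zero, zero_add]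
  have := congrArg p.2 hw
  rw [map_sum, map_zero] at this
  rw [← this]
  refine Finset.sum_congr rfl fun v _ => ?_
  rw [map_smul, zmodFour_smul_zmodTwo, mul_comm]

/-- The word with entries `1, -1, -1, 1` at `i`, `i + x`, `i + y`, `i + x + y`. -/
def parallelogramWord [DecidableEq B] (i x y : B) : B → ZMod 4 :=
  Pi.single i 1 - Pi.single (i + x) 1 - Pi.single (i + y) 1 + Pi.single (i + x + y) 1

theorem parallelogramWord_mem [DecidableEq B] (i x y : B) :
    parallelogramWord i x y ∈ parityCheckCode B := by
  simp only [parityCheckCode, parallelogramWord, LinearMap.mem_ker, map_add, map_sub,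
    Fintype.linearCombination_apply_single, one_smul, Prod.mk_sub_mk, Prod.mk_add_mk]
  ext
  · simp
  · simp; abel

omit [Module (ZMod 4) B] in
theorem sum_mul_lowBit_parallelogramWord [DecidableEq B] (q : B → ZMod 2) (i x y : B) :
    ∑ v, q v * lowBit (parallelogramWord i x y v) =
      q i + q (i + x) + q (i + y) + q (i + x + y) := by
  have h : ∀ (j : B), ∑ v, q v * lowBit ((Pi.single j 1 : B → ZMod 4) v) = q j := by
    intro j
    rw [Finset.sum_eq_single j]
    · simp
    · intro v _ hv
      simp [hv]
    · simp
  simp only [parallelogramWord, Pi.add_apply, Pi.sub_apply, map_add, map_sub, mul_add,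
    Finset.sum_add_distrib, h, CharTwo.sub_eq_add]

/-- Each of the nine coincidences forces `2w = 0` or puts `t` among `w, 2w, 3w`. -/
theorem parallelogram_disjoint {G : Type*} [AddCommGroup G] {w t s : G} (hw : w + w ≠ 0)
    (hw4 : w + w + w + w = 0) (ht1 : t ≠ w) (ht2 : t ≠ w + w) (ht3 : t ≠ w + w + w)
    (h : s = w ∨ s = t ∨ s = w + t) (h' : s = -w ∨ s = t - w ∨ s = -w + (t - w)) : False := by
  rcases h with rfl | rfl | rfl <;> rcases h' with h | h | h
  · exact hw (by linear_combination (norm := abel) h)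
  · exact ht2 (by linear_combination (norm := abel) -h)
  · exact ht3 (by linear_combination (norm := abel) -h)
  · exact ht3 (by linear_combination (norm := abel) h - hw4)
  · exact hw (by linear_combination (norm := abel) h + h)
  · exact hw (by linear_combination (norm := abel) h)
  · exact ht2 (by linear_combination (norm := abel) h - hw4)
  · exact hw (by linear_combination (norm := abel) h)
  · exact hw (by linear_combination (norm := abel) h + h - hw4)

/-- If the code contains words whose odd positions meet only in `i`, a constant check takes equal
values at both binary coordinates over `i`. -/
theorem eq_of_mem_constantChecks [DecidableEq B] {N : ℕ} (e : B ⊕ B ≃ Fin N) {w : B}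
    (hw : w + w ≠ 0) (hB : 4 < Fintype.card B) {y : BinWord N}
    (hy : y ∈ constantChecks (grayImage e (parityCheckCode B : Set (B → ZMod 4)))) (i : B) :
    y (e (Sum.inl i)) = y (e (Sum.inr i)) := by
  have hy' := (mem_constantChecks_grayImage e (parityCheckCode B).toAddSubgroup).1 hy
  -- Avoiding these four elements makes the two parallelograms below share only the vertex `i`.
  obtain ⟨t, ht⟩ : ∃ t, t ∉ ({0, w, w + w, w + w + w} : Finset B) := by
    by_contra! h
    have := Finset.card_le_card (fun t _ => h t : (Finset.univ : Finset B) ⊆ _)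
    have h4 := Finset.card_le_four (a := (0 : B)) (b := w) (c := w + w) (d := w + w + w)
    rw [Finset.card_univ] at this
    omega
  simp only [Finset.mem_insert, Finset.mem_singleton, not_or] at ht
  obtain ⟨ht0, ht1, ht2, ht3⟩ := ht
  have hw4 : w + w + w + w = 0 := by
    have : (4 : ZMod 4) • w = 0 := by rw [show (4 : ZMod 4) = 0 from rfl, zero_smul]
    rw [← this]
    module
  set c := parallelogramWord i w t
  set d := parallelogramWord i (-w) (t - w)
  have hc : c ∈ parityCheckCode B := parallelogramWord_mem _ _ _
  have hd : d ∈ parityCheckCode B := parallelogramWord_mem _ _ _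
  have h1 := hy' c hc
  have h2 := hy' d hd
  have h3 := hy' (c + d) (add_mem hc hd)
  have hprod : ∀ v, lowBit (c v) * lowBit (d v) = if v = i then 1 else 0 := by
    intro v
    obtain ⟨s, rfl⟩ : ∃ s, v = i + s := ⟨v - i, by abel⟩
    have hdisj : (s = w ∨ s = t ∨ s = w + t) →
        (s = -w ∨ s = t - w ∨ s = -w + (t - w)) → False := by
      intro h h'
      exact parallelogram_disjoint hw hw4 ht1 ht2 ht3 h h'
    have hw0 : w ≠ 0 := fun h => hw (by rw [h, add_zero])
    have hwt : w + t ≠ 0 := fun h => ht3 (by linear_combination (norm := abel) h - hw4)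
    have htw : t - w ≠ 0 := fun h => ht1 (sub_eq_zero.1 h)
    have hwtw : -w + (t - w) ≠ 0 := fun h => ht2 (by linear_combination (norm := abel) h)
    simp only [c, d, parallelogramWord, Pi.add_apply, Pi.sub_apply, Pi.single_apply, add_assoc,
      add_right_inj, add_eq_left]
    by_cases hs : s = 0
    · subst hs
      simp [hw0.symm, hwt.symm, htw.symm, hwtw.symm, Ne.symm ht0, hw0]
    · by_cases h : s = w ∨ s = t ∨ s = w + t
      · have h' := fun h' => hdisj h h'
        simp only [imp_false, not_or] at h'
        simp [hs, h']
      · simp only [not_or] at h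
        simp [hs, h]
  -- Adding the check equations for `c`, `d` and `c + d` leaves only the product terms, which are
  -- supported at `i`.
  have hsum : ∑ v, (y (e (Sum.inl v)) + y (e (Sum.inr v))) * (lowBit (c v) * lowBit (d v)) = 0 := by
    rw [← h3, ← zero_add (∑ v, _), ← zero_add (∑ v, _), ← add_assoc]
    nth_rewrite 1 [← h1]
    rw [← h2, ← Finset.sum_add_distrib, ← Finset.sum_add_distrib]
    refine Finset.sum_congr rfl fun v _ => ?_
    rw [Pi.add_apply, grayBeta_add, grayGamma_add]
    ring
  simp only [hprod] at hsum
  simpa [CharTwo.add_eq_zero] using hsum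

/-- A check agrees on the two copies of `B`, and orthogonality to the parallelogram words makes the
common function affine, so it is one of those already counted. -/
theorem ncard_constantChecks_le {N : ℕ} (e : B ⊕ B ≃ Fin N) {w : B}
    (hw : w + w ≠ 0) (hB : 4 < Fintype.card B) :
    (constantChecks (grayImage e (parityCheckCode B : Set (B → ZMod 4)))).ncard ≤
      Nat.card (ZMod 2 × (B →ₗ[ZMod 4] ZMod 2)) := by
  classical
  have key : ∀ y ∈ constantChecks (grayImage e (parityCheckCode B : Set (B → ZMod 4))),
      ∃ p : ZMod 2 × (B →ₗ[ZMod 4] ZMod 2), ∀ v,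
        y (e (Sum.inl v)) = p.1 + p.2 v ∧ y (e (Sum.inr v)) = p.1 + p.2 v := by
    intro y hy
    have hlr := eq_of_mem_constantChecks e hw hB hy
    set q : B → ZMod 2 := fun v => y (e (Sum.inl v)) with hq
    have hpar : ∀ x z, q 0 + q x + q z + q (x + z) = 0 := by
      intro x z
      have h := (mem_constantChecks_grayImage e (parityCheckCode B).toAddSubgroup).1 hy _
        (parallelogramWord_mem 0 x z)
      simp only [← hlr, ← mul_add, grayBeta_add_grayGamma] at h
      rw [sum_mul_lowBit_parallelogramWord q] at h
      simpa using h
    let ψ : B →+ ZMod 2 := AddMonoidHom.mk' (fun v => q 0 + q v) (by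
      intro x z
      have h := hpar x z
      have hz : ∀ a b c d : ZMod 2, a + b + c + d = 0 → a + d = a + b + (a + c) := by decide
      exact hz _ _ _ _ h)
    refine ⟨(q 0, ψ.toZModLinearMap 4), fun v => ?_⟩
    have hv : q 0 + (ψ.toZModLinearMap 4) v = q v := by
      change q 0 + (q 0 + q v) = q v
      rw [← add_assoc, CharTwo.add_self_eq_zero, zero_add]
    exact ⟨hv.symm, (hlr v).symm.trans hv.symm⟩
  choose! p hp using key
  have hfin : Finite (B →ₗ[ZMod 4] ZMod 2) := DFunLike.finite _
  rw [← Set.ncard_univ]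
  refine Set.ncard_le_ncard_of_injOn p (fun _ _ => Set.mem_univ _) ?_ (Set.toFinite _)
  intro y hy z hz hyz
  funext j
  obtain ⟨x, rfl⟩ := e.surjective j
  rcases x with v | v
  · rw [(hp y hy v).1, (hp z hz v).1, hyz]
  · rw [(hp y hy v).2, (hp z hz v).2, hyz]

end Invariant

/-! ### Modules over `Z_4` and their characters -/

section Structure

theorem exists_linearEquiv_pi_prod (B : Type*) [Finite B] [AddCommGroup B] [Module (ZMod 4) B] :
    ∃ j b : ℕ, Nonempty (B ≃ₗ[ZMod 4] (Fin j → ZMod 4) × (Fin b → ZMod 2)) := by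
  classical
  obtain ⟨ι, _, n, hn, ⟨e⟩⟩ := AddCommGroup.equiv_directSum_zmod_of_finite' B
  let e₁ : B ≃+ ∀ i, ZMod (n i) := e.trans (DirectSum.addEquivProd _)
  have hdvd : ∀ i, n i ∣ 4 := by
    intro i
    have h : (4 : ℕ) • e₁.symm (Pi.single i 1) = 0 := by
      rw [← Nat.cast_smul_eq_nsmul (ZMod 4), show ((4 : ℕ) : ZMod 4) = 0 from rfl, zero_smul]
    rw [← map_nsmul, EmbeddingLike.map_eq_zero_iff] at h
    have := congrFun h i
    rw [← ZMod.natCast_eq_zero_iff]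
    simpa using this
  have htwo : ∀ i, n i ≠ 4 → n i = 2 := by
    intro i hi
    have h1 := hn i
    have h2 := hdvd i
    have h3 := Nat.le_of_dvd (by norm_num) h2
    interval_cases hh : n i <;> simp_all
  let e₂ : (∀ i, ZMod (n i)) ≃+
      (∀ i : {i // n i = 4}, ZMod (n i)) × (∀ i : {i // n i ≠ 4}, ZMod (n i)) :=
    { Equiv.piEquivPiSubtypeProd (fun i => n i = 4) (fun i => ZMod (n i)) with
      map_add' := fun _ _ => rfl }
  let e₃ : (∀ i : {i // n i = 4}, ZMod (n i)) ≃+ ({i // n i = 4} → ZMod 4) :=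
    AddEquiv.piCongrRight fun i => (ZMod.ringEquivCongr i.2).toAddEquiv
  let e₄ : (∀ i : {i // n i ≠ 4}, ZMod (n i)) ≃+ ({i // n i ≠ 4} → ZMod 2) :=
    AddEquiv.piCongrRight fun i => (ZMod.ringEquivCongr (htwo i i.2)).toAddEquiv
  let e₅ : B ≃+ ({i // n i = 4} → ZMod 4) × ({i // n i ≠ 4} → ZMod 2) :=
    (e₁.trans e₂).trans (AddEquiv.prodCongr e₃ e₄)
  let e₆ : B ≃ₗ[ZMod 4] ({i // n i = 4} → ZMod 4) × ({i // n i ≠ 4} → ZMod 2) :=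
    { e₅ with map_smul' := ZMod.map_smul e₅.toAddMonoidHom }
  exact ⟨_, _, ⟨e₆.trans (LinearEquiv.prodCongr
    (LinearEquiv.funCongrLeft (ZMod 4) (ZMod 4) (Fintype.equivFin _).symm)
    (LinearEquiv.funCongrLeft (ZMod 4) (ZMod 2) (Fintype.equivFin _).symm))⟩⟩

theorem card_zmodTwo_linearMap : Nat.card (ZMod 2 →ₗ[ZMod 4] ZMod 2) = 2 := by
  let F : (ZMod 2 →ₗ[ZMod 4] ZMod 2) ≃ ZMod 2 :=
    { toFun := fun f => f 1
      invFun := fun x => (AddMonoidHom.mulRight x).toZModLinearMap 4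
      left_inv := fun f => by
        ext x
        have hx : x = (x.val : ZMod 4) • (1 : ZMod 2) := by revert x; decide
        change x * f 1 = f x
        conv_rhs => rw [hx, map_smul]
        rw [zmodFour_smul_zmodTwo]
        congr 1
        revert x
        decide
      right_inv := fun x => one_mul x }
  rw [Nat.card_congr F, Nat.card_zmod]

theorem card_pi_prod_linearMap (j b : ℕ) :
    Nat.card ((Fin j → ZMod 4) × (Fin b → ZMod 2) →ₗ[ZMod 4] ZMod 2) = 2 ^ (j + b) := by
  rw [Nat.card_congr (LinearMap.coprodEquiv (ZMod 4)).symm.toEquiv, Nat.card_prod,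
    Nat.card_congr (LinearMap.lsum (ZMod 4) (fun _ : Fin j => ZMod 4) (ZMod 4)).symm.toEquiv,
    Nat.card_congr (LinearMap.lsum (ZMod 4) (fun _ : Fin b => ZMod 2) (ZMod 4)).symm.toEquiv,
    Nat.card_pi, Nat.card_pi, card_zmodTwo_linearMap,
    Nat.card_congr (LinearMap.ringLmapEquivSelf (ZMod 4) (ZMod 4) (ZMod 2)).toEquiv]
  simp [pow_add]

end Structure

/-! ### Self-injectivity of `Z_4` and sum-free sets -/

section Lifting

theorem zmodFour_dvd_of_annihilator : ∀ x y : ZMod 4, (∀ r, r * x = 0 → r * y = 0) →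
    ∃ z, y = x * z := by
  decide

theorem zmodFour_ideal_principal (I : Ideal (ZMod 4)) : ∃ x, I = Ideal.span {x} := by
  have := IsPrincipalIdealRing.of_surjective (Int.castRingHom (ZMod 4)) ZMod.intCast_surjective
  obtain ⟨x, hx⟩ := (IsPrincipalIdealRing.principal I).principal
  exact ⟨x, hx⟩

/-- Ideals of `Z_4` are principal, so extending a map on an ideal amounts to dividing the image of a
generator by that generator; the annihilator condition makes this possible. -/
theorem zmodFour_baer : Module.Baer (ZMod 4) (ZMod 4) := by
  intro I g
  obtain ⟨x, rfl⟩ := zmodFour_ideal_principal I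
  have hx : x ∈ Ideal.span {x} := Ideal.mem_span_singleton_self x
  obtain ⟨z, hz⟩ := zmodFour_dvd_of_annihilator x (g ⟨x, hx⟩) (by
    intro r hr
    rw [← smul_eq_mul, ← map_smul]
    rw [show r • (⟨x, hx⟩ : Ideal.span {x}) = 0 from Subtype.ext hr, map_zero])
  refine ⟨LinearMap.toSpanSingleton (ZMod 4) (ZMod 4) z, ?_⟩
  intro y hy
  obtain ⟨a, rfl⟩ := Ideal.mem_span_singleton'.1 hy
  rw [show (⟨a * x, hy⟩ : Ideal.span {x}) = a • ⟨x, hx⟩ from rfl, map_smul, hz]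
  simp [mul_assoc]

theorem double_eq_imp_lowBit : ∀ (a : ZMod 4) (b : ZMod 2),
    2 * a = 2 * (b.val : ZMod 4) → lowBit a = b := by
  decide

theorem two_mul_val_add : ∀ a b : ZMod 2,
    (2 * ((a + b).val : ZMod 4) : ZMod 4) = 2 * (a.val : ZMod 4) + 2 * (b.val : ZMod 4) := by
  decide

/-- A character of order two that vanishes on the elements of order two lifts to `ZMod 4`. -/
theorem exists_lowBit_lift {A : Type} [AddCommGroup A] [Module (ZMod 4) A] (χ : A →+ ZMod 2)
    (hχ : ∀ x, x + x = 0 → χ x = 0) :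
    ∃ r : A →ₗ[ZMod 4] ZMod 4, ∀ x, lowBit (r x) = χ x := by
  let D : A →ₗ[ZMod 4] A := LinearMap.id + LinearMap.id
  let g : A →ₗ[ZMod 4] ZMod 4 :=
    (AddMonoidHom.mk' (fun x => 2 * ((χ x).val : ZMod 4)) (fun x y => by
      rw [map_add, two_mul_val_add])).toZModLinearMap 4
  -- Thus `2x ↦ 2 χ(x)` is well defined on `2A`. Any extension `r` to `A` satisfies `2 r(x) = 2
  -- χ(x)`, which says that `r` reduces to `χ`.
  have hle : LinearMap.ker D ≤ LinearMap.ker g := by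
    intro x hx
    change 2 * ((χ x).val : ZMod 4) = 0
    rw [hχ x hx]
    rfl
  have hinj : Function.Injective ((LinearMap.ker D).liftQ D le_rfl) := by
    rw [← LinearMap.ker_eq_bot]
    exact Submodule.ker_liftQ_eq_bot _ _ _ le_rfl
  obtain ⟨r, hr⟩ := Module.Baer.extension_property zmodFour_baer _ hinj
    ((LinearMap.ker D).liftQ g hle)
  refine ⟨r, fun x => double_eq_imp_lowBit _ _ ?_⟩
  have := LinearMap.congr_fun hr (Submodule.Quotient.mk x)
  change r (x + x) = 2 * ((χ x).val : ZMod 4) at this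
  rw [← this, map_add, two_mul]

/-- A symmetric sum-free set containing half of the elements is the complement of a subgroup of
index two. -/
theorem exists_character_of_sum_free {A : Type*} [AddCommGroup A] [Finite A] {S : Set A}
    (hneg : ∀ x ∈ S, -x ∈ S) (hsum : ∀ x ∈ S, ∀ y ∈ S, x + y ∉ S)
    (hcard : 2 * S.ncard = Nat.card A) :
    ∃ χ : A →+ ZMod 2, ∀ x, χ x = 1 ↔ x ∈ S := by
  classical
  have hcompl : S.ncard = Sᶜ.ncard := by
    have := Set.ncard_add_ncard_compl S
    omega
  have hin : ∀ x ∈ S, ∀ y ∉ S, x + y ∈ S := by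
    intro x hx y hy
    -- Translation by `-x` sends `S` into its complement, and the two have equal size, so it is
    -- onto.
    have himg : (fun z => -x + z) '' S = Sᶜ := by
      refine Set.eq_of_subset_of_ncard_le ?_ ?_ (Set.toFinite _)
      · rintro _ ⟨z, hz, rfl⟩
        exact hsum _ (hneg x hx) z hz
      · rw [Set.ncard_image_of_injective _ (add_right_injective (-x)), hcompl]
    obtain ⟨z, hz, hzy⟩ : y ∈ (fun z => -x + z) '' S := by rw [himg]; exact hy
    rw [← hzy]
    simpa using hz
  have hout : ∀ x ∉ S, ∀ y ∉ S, x + y ∉ S := by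
    intro x hx y hy hxy
    have := hin _ hxy (-x) (fun h => hx (by simpa using hneg _ h))
    exact hy (by simpa using this)
  refine ⟨AddMonoidHom.mk' (fun x => if x ∈ S then 1 else 0) fun x y => ?_, fun x => ?_⟩
  · by_cases hx : x ∈ S <;> by_cases hy : y ∈ S
    · simp [hx, hy, hsum x hx y hy, CharTwo.add_self_eq_zero]
    · simp [hx, hy, hin x hx y hy]
    · simp [hx, hy, add_comm x y, hin y hy x hx]
    · simp [hx, hy, hout x hx y hy]
  · simp

end Lifting

/-! ### Every perfect quaternary code is a parity-check code -/

section Classification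

/-- The units `1` and `-1` of `ZMod 4`. -/
def boolUnit (b : Bool) : ZMod 4 := if b then 1 else -1

theorem boolUnit_injective : Function.Injective boolUnit := by decide

theorem exists_boolUnit_of_lowBit : ∀ x : ZMod 4, lowBit x = 1 → ∃ b, x = boolUnit b := by decide

theorem boolUnit_mul_self : ∀ b, boolUnit b * boolUnit b = 1 := by decide

theorem leeSymbol_boolUnit : ∀ b, leeSymbol (boolUnit b) = 1 := by decide

theorem neg_boolUnit : ∀ b, -boolUnit b = boolUnit (!b) := by decide

theorem boolUnit_add_ne : ∀ a b c, boolUnit a + boolUnit b ≠ boolUnit c := by decide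

theorem boolUnit_add_self_ne : ∀ a, boolUnit a + boolUnit a ≠ 0 := by decide

theorem boolUnit_ne_zero : ∀ a, boolUnit a ≠ 0 := by decide

theorem boolUnit_eq_one_or : ∀ b, boolUnit b = 1 ∨ boolUnit b = -1 := by decide

theorem eq_of_mul_boolUnit : ∀ a b, boolUnit a * boolUnit b = 1 → a = b := by decide

/-- Every quaternary code with the parameters of an extended perfect code is, up to a signed
permutation of the coordinates, a parity-check code. -/
theorem exists_parityCheckCode_of_perfect {n : ℕ} (hn : 0 < n)
    (𝒞 : AddSubgroup (Fin n → ZMod 4)) (hcard : Nat.card 𝒞 * (4 * n) = 4 ^ n)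
    (hlee : ∀ c ∈ 𝒞, c ≠ 0 → 4 ≤ leeWeight c) :
    ∃ (B : Type) (_ : AddCommGroup B) (_ : Module (ZMod 4) B) (_ : Fintype B) (σ : Fin n ≃ B)
      (ε : Fin n → ZMod 4), (∀ i, ε i = 1 ∨ ε i = -1) ∧
      ∀ c : B → ZMod 4, c ∈ parityCheckCode B ↔ (fun i => ε i * c (σ i)) ∈ 𝒞 := by
  classical
  set P : Submodule (ZMod 4) (Fin n → ZMod 4) := AddSubgroup.toZModSubmodule 4 𝒞 with hP
  have hmemP : ∀ c, c ∈ P ↔ c ∈ 𝒞 := fun c => AddSubgroup.mem_toZModSubmodule 4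
  let A := (Fin n → ZMod 4) ⧸ P
  have hzero : ∀ c ∈ P, leeWeight c ≤ 3 → c = 0 := by
    intro c hc h3
    by_contra h0
    have := hlee c ((hmemP c).1 hc) h0
    omega
  have hcardA : Nat.card A = 4 * n := by
    have h := Submodule.card_eq_card_quotient_mul_card P
    have h2 : Nat.card P = Nat.card 𝒞 := rfl
    have h1 : Nat.card (Fin n → ZMod 4) = 4 ^ n := by simp
    have hpos : 0 < Nat.card 𝒞 := Nat.card_pos
    rw [h1, h2, ← hcard] at h
    exact (Nat.eq_of_mul_eq_mul_left hpos h).symm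
  let g : Fin n × Bool → A := fun p => P.mkQ (Pi.single p.1 (boolUnit p.2))
  have hlg : ∀ (i : Fin n) b, leeWeight (Pi.single i (boolUnit b)) = 1 := by
    intro i b
    rw [leeWeight_single, leeSymbol_boolUnit]
  have hneg : ∀ p, -g p = g (p.1, !p.2) := by
    intro p
    simp only [g]
    rw [← map_neg, ← Pi.single_neg, neg_boolUnit]
  have hmk : ∀ c, P.mkQ c = 0 → leeWeight c ≤ 3 → c = 0 := by
    intro c hc
    exact hzero c (by simpa using hc)
  have hginj : Function.Injective g := by
    rintro ⟨i, a⟩ ⟨j, b⟩ hab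
    have h0 : (Pi.single i (boolUnit a) + Pi.single j (boolUnit (!b)) : Fin n → ZMod 4) = 0 := by
      refine hmk _ ?_ ((leeWeight_add_le _ _).trans (by simp only [hlg]; norm_num))
      rw [map_add]
      change g (i, a) + g (j, !b) = 0
      rw [hab, ← hneg (j, b), add_neg_cancel]
    rw [← neg_boolUnit, Pi.single_neg, add_neg_eq_zero] at h0
    have hij : i = j := by
      by_contra hij
      have := congrFun h0 i
      rw [Pi.single_eq_same, Pi.single_eq_of_ne hij] at this
      exact boolUnit_ne_zero a this
    subst hij
    rw [boolUnit_injective (Pi.single_injective i h0)]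
  let S : Set A := Set.range g
  have hScard : S.ncard = 2 * n := by
    rw [show S = g '' Set.univ from Set.image_univ.symm, Set.ncard_image_of_injective _ hginj, Set.ncard_univ]
    simp [mul_comm]
  have hsumS : ∀ x ∈ S, ∀ y ∈ S, x + y ∉ S := by
    rintro _ ⟨p, rfl⟩ _ ⟨q, rfl⟩ ⟨s, hs⟩
    have h0 : (Pi.single p.1 (boolUnit p.2) + Pi.single q.1 (boolUnit q.2) +
        Pi.single s.1 (boolUnit (!s.2)) : Fin n → ZMod 4) = 0 := by
      refine hmk _ ?_ ((leeWeight_add_le _ _).trans ?_)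
      · rw [map_add, map_add]
        change g p + g q + g (s.1, !s.2) = 0
        rw [← hneg, hs, add_neg_cancel]
      · rw [hlg]
        have := leeWeight_add_le (Pi.single p.1 (boolUnit p.2)) (Pi.single q.1 (boolUnit q.2))
        simp only [hlg] at this
        omega
    -- A sum of three units is odd. Summing all coordinates thus covers every coincidence among the
    -- three positions at once.
    have h1 := congrArg (fun c : Fin n → ZMod 4 => ∑ i, c i) h0
    simp only [Pi.add_apply, Finset.sum_add_distrib, Finset.sum_pi_single', Finset.mem_univ,
      if_true, Pi.zero_apply, Finset.sum_const_zero, ← neg_boolUnit, add_neg_eq_zero] at h1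
    exact boolUnit_add_ne _ _ _ h1
  have : Finite A := Nat.finite_of_card_ne_zero (by omega)
  obtain ⟨χ, hχ⟩ := exists_character_of_sum_free (S := S)
    (by rintro _ ⟨p, rfl⟩; exact ⟨_, (hneg p).symm⟩) hsumS (by omega)
  obtain ⟨r, hr⟩ := exists_lowBit_lift χ (by
    intro x hx
    by_contra h
    have h1 : χ x = 1 := by
      revert h
      generalize χ x = y
      revert y
      decide
    obtain ⟨p, rfl⟩ := (hχ x).1 h1
    -- Otherwise the code would contain `2e_i`, of Lee weight 2.
    have h0 : (Pi.single p.1 (boolUnit p.2) + Pi.single p.1 (boolUnit p.2) : Fin n → ZMod 4)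
        = 0 := by
      refine hmk _ ?_ ((leeWeight_add_le _ _).trans (by simp only [hlg]; norm_num))
      rw [map_add]
      exact hx
    have := congrFun h0 p.1
    simp only [Pi.add_apply, Pi.single_eq_same] at this
    exact boolUnit_add_self_ne _ this)
  let h : Fin n → A := fun i => P.mkQ (Pi.single i 1)
  have hgh : ∀ i b, g (i, b) = boolUnit b • h i := by
    intro i b
    simp only [g, h]
    rw [← map_smul, ← Pi.single_smul, smul_eq_mul, mul_one]
  have hodd : ∀ i, ∃ b, r (h i) = boolUnit b := by
    intro i
    refine exists_boolUnit_of_lowBit _ ?_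
    rw [hr, hχ]
    exact ⟨(i, true), by rw [hgh]; exact one_smul _ _⟩
  choose s hs using hodd
  have hr1 : ∀ i, r (g (i, s i)) = 1 := by
    intro i
    rw [hgh, map_smul, hs, smul_eq_mul, boolUnit_mul_self]
  let i₀ : Fin n := ⟨0, hn⟩
  let t : A := g (i₀, s i₀)
  let σ₀ : Fin n → LinearMap.ker r := fun i => ⟨g (i, s i) - t, by
    rw [LinearMap.mem_ker, map_sub, hr1, hr1, sub_self]⟩
  -- For surjectivity, `r(x + t) = 1` puts `x + t` in `S`, so it is some `±h i`, and the value 1 of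
  -- `r` fixes the sign as `s i`.
  have hσ₀ : Function.Bijective σ₀ := by
    constructor
    · intro i j hij
      have h1 : g (i, s i) - t = g (j, s j) - t := congrArg Subtype.val hij
      exact congrArg Prod.fst (hginj (sub_left_injective h1))
    · rintro ⟨x, hx⟩
      have h1 : r (x + t) = 1 := by rw [map_add, LinearMap.mem_ker.1 hx, hr1, zero_add]
      obtain ⟨⟨i, b⟩, hib⟩ := (hχ (x + t)).1 (by rw [← hr, h1, map_one])
      refine ⟨i, Subtype.ext ?_⟩
      rw [← hib, hgh, map_smul, hs, smul_eq_mul] at h1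
      change g (i, s i) - t = x
      rw [← eq_of_mul_boolUnit _ _ h1, hib, add_sub_cancel_right]
  let σ := Equiv.ofBijective σ₀ hσ₀
  refine ⟨LinearMap.ker r, inferInstance, inferInstance, Fintype.ofEquiv _ σ, σ,
    fun i => boolUnit (s i), fun i => boolUnit_eq_one_or _, fun c => ?_⟩
  let : Fintype (LinearMap.ker r) := Fintype.ofEquiv _ σ
  -- The syndrome in `A = ker r ⊕ Z_4 t`; applying `r`, with `r t = 1`, isolates the coordinate sum.
  have hq : P.mkQ (fun i => boolUnit (s i) * c (σ i)) =
      ∑ v, c v • (v : A) + (∑ v, c v) • t := by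
    have h1 : (fun i => boolUnit (s i) * c (σ i)) =
        ∑ i, (boolUnit (s i) * c (σ i)) • (Pi.single i 1 : Fin n → ZMod 4) :=
      pi_eq_sum_univ' _
    rw [h1, map_sum, ← Equiv.sum_comp σ c, ← Equiv.sum_comp σ (fun v => c v • (v : A)),
      Finset.sum_smul, ← Finset.sum_add_distrib]
    refine Finset.sum_congr rfl fun i _ => ?_
    have h2 : ((σ i : LinearMap.ker r) : A) = g (i, s i) - t := rfl
    rw [h2, ← smul_add, sub_add_cancel, hgh, map_smul, mul_comm, mul_smul]
  rw [← hmemP, ← Submodule.Quotient.mk_eq_zero P, ← Submodule.mkQ_apply, hq, mem_parityCheckCode]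
  constructor
  · rintro ⟨h1, h2⟩
    rw [h1, zero_smul, add_zero]
    simpa using congrArg Subtype.val h2
  · intro h0
    have h1 : ∑ v, c v = 0 := by
      have := congrArg r h0
      simpa [hr1, t] using this
    refine ⟨h1, Subtype.ext ?_⟩
    rw [h1, zero_smul, add_zero] at h0
    simpa using h0

end Classification

/-! ### Counting the types `(j, b)` -/

section Counting

/-- The module `Z_4^j × Z_2^b`. -/
abbrev TypeModule (j b : ℕ) : Type := (Fin j → ZMod 4) × (Fin b → ZMod 2)

theorem card_typeModule (j b : ℕ) : Fintype.card (TypeModule j b) = 2 ^ (2 * j + b) := by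
  simp [pow_add, pow_mul]

theorem exists_add_self_ne_zero {j : ℕ} (b : ℕ) (hj : 0 < j) :
    ∃ w : TypeModule j b, w + w ≠ 0 := by
  refine ⟨(fun _ => 1, 0), fun h => ?_⟩
  have := congrFun (congrArg Prod.fst h) ⟨0, hj⟩
  exact absurd (show (1 : ZMod 4) + 1 = 0 from this) (by decide)

/-- Among modules of a fixed order, a larger number of summands `Z_4` gives an inequivalent code. -/
theorem not_codeEquiv_of_lt {N j b j' b' : ℕ} (e : TypeModule j b ⊕ TypeModule j b ≃ Fin N)
    (e' : TypeModule j' b' ⊕ TypeModule j' b' ≃ Fin N) (hb : 2 * j + b = 2 * j' + b')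
    (hj : j < j') (h3 : 3 ≤ 2 * j' + b') :
    ¬ CodeEquiv (grayImage e (parityCheckCode (TypeModule j b) : Set (TypeModule j b → ZMod 4)))
      (grayImage e'
        (parityCheckCode (TypeModule j' b') : Set (TypeModule j' b' → ZMod 4))) := by
  intro h
  obtain ⟨w, hw⟩ := exists_add_self_ne_zero b' (show 0 < j' by omega)
  have hB : 4 < Fintype.card (TypeModule j' b') := by
    rw [card_typeModule]
    calc 4 < 2 ^ 3 := by norm_num
      _ ≤ _ := Nat.pow_le_pow_right (by norm_num) h3
  -- The smaller index `j` may be 0, so only the lower bound, which needs no element of order 4, is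
  -- used for it.
  have h1 := card_le_ncard_constantChecks e
  have h2 := ncard_constantChecks_le e' hw hB
  rw [ncard_constantChecks_eq_of_codeEquiv h] at h1
  have h4 := h1.trans h2
  rw [Nat.card_prod, Nat.card_prod, card_pi_prod_linearMap, card_pi_prod_linearMap,
    Nat.card_zmod] at h4
  have h5 := (Nat.pow_le_pow_iff_right (by norm_num)).1 (Nat.le_of_mul_le_mul_left h4 two_pos)
  omega

theorem exists_typeModule_codeEquiv {k : ℕ} {C : Set (BinWord (2 ^ k))}
    (hZ : IsZ4Linear C) (hC : IsBinaryCode (2 ^ k) (2 ^ 2 ^ k / (2 * 2 ^ k)) 4 C) :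
    ∃ j b : ℕ, 2 * j + b + 1 = k ∧
      ∀ e : TypeModule j b ⊕ TypeModule j b ≃ Fin (2 ^ k),
        CodeEquiv C (grayImage e
          (parityCheckCode (TypeModule j b) : Set (TypeModule j b → ZMod 4))) := by
  obtain ⟨n, 𝒞, e, rfl⟩ := isZ4Linear_iff_exists_grayImage.1 hZ
  have hnN : n + n = 2 ^ k := by simpa using Fintype.card_congr e
  have hpos : 0 < 2 ^ k := by positivity
  obtain ⟨hcard, hlee⟩ := (isBinaryCode_grayImage e 𝒞).1 hC
  -- The prescribed cardinality is a natural-number quotient, so exactness must be checked.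
  have hdvd : 2 * 2 ^ k ∣ 2 ^ 2 ^ k := by
    rw [← pow_succ']
    exact pow_dvd_pow 2 Nat.lt_two_pow_self
  have hcard' : Nat.card 𝒞 * (4 * n) = 4 ^ n := by
    rw [hcard, show 4 * n = 2 * 2 ^ k by omega, Nat.div_mul_cancel hdvd, ← hnN, ← two_mul,
      pow_mul]
    norm_num
  obtain ⟨B, _, _, _, σ, ε, hε, hmem⟩ :=
    exists_parityCheckCode_of_perfect (by omega) 𝒞 hcard' hlee
  obtain ⟨j, b, ⟨θ⟩⟩ := exists_linearEquiv_pi_prod B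
  have hB : Fintype.card B = n := by simpa using (Fintype.card_congr σ).symm
  have hjb : 2 * j + b + 1 = k := by
    have h := Fintype.card_congr θ.toEquiv
    rw [card_typeModule, hB] at h
    refine Nat.pow_right_injective le_rfl ?_
    change 2 ^ (2 * j + b + 1) = 2 ^ k
    rw [pow_succ, ← h]
    omega
  refine ⟨j, b, hjb, fun e'' => ?_⟩
  let e' : B ⊕ B ≃ Fin (2 ^ k) := (Equiv.sumCongr σ.symm σ.symm).trans e
  exact (codeEquiv_grayImage e e' σ ε hε hmem).trans (codeEquiv_parityCheckCode e' e'' θ)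

/-- A labelling of the binary coordinates by two copies of `Z_4^j × Z_2^b`. -/
noncomputable def typeLabelling {j b k : ℕ} (h : 2 * j + b + 1 = k) :
    TypeModule j b ⊕ TypeModule j b ≃ Fin (2 ^ k) :=
  Fintype.equivFinOfCardEq (by
    rw [Fintype.card_sum, card_typeModule, ← h, pow_succ, mul_two])

/-- The extended perfect code with parity-check columns indexed by `Z_4^j × Z_2^b`. -/
noncomputable def typeCode {j b k : ℕ} (h : 2 * j + b + 1 = k) :
    Z4LinearExtendedPerfectCode (2 ^ k) :=
  ⟨grayImage (typeLabelling h)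
      (parityCheckCode (TypeModule j b) : Set (TypeModule j b → ZMod 4)),
    isZ4Linear_grayImage _ (parityCheckCode (TypeModule j b)).toAddSubgroup,
    isBinaryCode_grayImage_parityCheckCode (by positivity) _⟩

end Counting

theorem theorem6 (N k : ℕ) (hN : N = 2 ^ k) (h16 : 16 ≤ N) :
    Nat.card (Quotient (z4CodeSetoid N)) = (k + 1) / 2 := by
  subst hN
  have hk : 4 ≤ k := by
    rw [show 16 = 2 ^ 4 by norm_num] at h16
    exact (Nat.pow_le_pow_iff_right (by norm_num)).1 h16
  -- The bound on `j` is exactly `2j ≤ k - 1`, so the truncated subtraction is exact.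
  have hb : ∀ j : Fin ((k + 1) / 2), 2 * j.1 + (k - 1 - 2 * j.1) + 1 = k := by
    intro j
    have := j.2
    omega
  let F : Fin ((k + 1) / 2) → Quotient (z4CodeSetoid (2 ^ k)) := fun j =>
    Quotient.mk _ (typeCode (hb j))
  have hlt : ∀ i j, i < j → F i ≠ F j := by
    intro i j hij h
    have hi := hb i
    have hj := hb j
    exact not_codeEquiv_of_lt (typeLabelling hi) (typeLabelling hj) (by omega) hij (by omega)
      (Quotient.exact h)
  have hF : Function.Bijective F := by
    constructor
    · intro i j hij
      rcases lt_trichotomy i j with h | h | h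
      · exact absurd hij (hlt i j h)
      · exact h
      · exact absurd hij.symm (hlt j i h)
    · intro q
      induction q using Quotient.inductionOn with
      | h C =>
        obtain ⟨j, b, hjb, hC⟩ := exists_typeModule_codeEquiv C.2.1 C.2.2
        obtain rfl : b = k - 1 - 2 * j := by omega
        exact ⟨⟨j, by omega⟩, Quotient.sound (hC _).symm⟩
  rw [← Nat.card_eq_of_bijective F hF, Nat.card_fin]
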